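/- Let $\mathcal H_1,\mathcal H_2,\mathcal H$ be separable real Hilbert spaces. Let $\mathcal B_2(\mathcal H_1;\mathcal H_2)$ be the Hilbert space of Hilbert--Schmidt operators from $\mathcal H_1$ to $\mathcal H_2$, with inner product $\langle G,K\rangle=\sum_j\langle Ge_j,Ke_j\rangle_{\mathcal H_2}$ for an orthonormal basis $(e_j)$ of $\mathcal H_1$, and norm $\|\cdot\|_{\mathrm{HS}}$. For $G\in\mathcal B_2(\mathcal H_1;\mathcal H_2)$ let $\|G\|$ be its operator norm and $\|G\|_*\in[0,+\infty]$ its nuclear norm, i.e. the sum of its singular values, repeated according to multiplicity. For $u\in\mathcal H_1$, $v\in\mathcal H_2$ let $u\otimes v$ be the operator $a\mapsto\langle u,a\rangle v$. Let $N\ge 1$ and let $\Phi\colon\mathcal B_2(\mathcal H_1;\mathcal H_2)^N\to\mathcal H$ be a bounded linear operator. Let $u_i\in\mathcal H_1$, $v_i\in\mathcal H_2$ be unit vectors and $\sigma_i>0$ ($1\le i\le N$), and put $F^\dagger=(\sigma_i\,u_i\otimes v_i)_{1\le i\le N}$ and $z=\Phi F^\dagger$. Let $$T=\prod_{i=1}^N\{u_i\otimes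 a+b\otimes v_i:\ a\in\mathcal H_2,\ b\in\mathcal H_1\}.$$ Assume that: 1. the restriction $\Phi|_T$ is injective and has closed range; 2. (non-degenerate source condition) there is $K\in\operatorname{Im}(\Phi^*)$ such that for every $1\le i\le N$ one has $K_i=u_i\otimes v_i+W_i$ with $W_i\in\mathcal B_2(\mathcal H_1;\mathcal H_2)$, $W_iu_i=0$, $W_i^*v_i=0$ and $\|W_i\|<1$. Then for every $c>0$ there is a constant $C$ (depending on $\Phi$, $F^\dagger$ and $c$, but not on $\delta$, $z^\delta$ or $F^\delta$) such that for every $\delta>0$, every $z^\delta\in\mathcal H$ with $\|z^\delta-z\|_{\mathcal H}\le\delta$ and every minimizer $F^\delta$ over $\mathcal B_2(\mathcal H_1;\mathcal H_2)^N$ of $$F\mapsto\tfrac12\|\Phi F-z^\delta\|_{\mathcal H}^2+\lambda\sum_{i=1}^N\|F_i\|_*\qquad\text{with }\lambda=c\,\delta,$$ one has $$\sum_{i=1}^N\|F^\delta_i-F^\dagger_i\|_{\mathrm{HS}}\le C\,\delta .$$ -/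

import Mathlib

open scoped ENNReal NNReal

noncomputable section

namespace NuclearRecovery

section HilbertSchmidt

variable {E F : Type*} [NormedAddCommGroup E] [InnerProductSpace ℝ E]
  [NormedAddCommGroup F] [InnerProductSpace ℝ F]

/-- Parseval's identity, with values in `[0, ∞]`. -/
theorem tsum_ofReal_inner_sq {ι : Type*} (b : HilbertBasis ι ℝ E) (x : E) :
    ∑' i, ENNReal.ofReal ((inner ℝ (b i) x) ^ 2) = ENNReal.ofReal (‖x‖ ^ 2) := by
  have h : HasSum (fun i => (inner ℝ (b i) x) ^ 2) (‖x‖ ^ 2) := by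
    have h := b.hasSum_inner_mul_inner x x
    rw [real_inner_self_eq_norm_sq] at h
    refine h.congr_fun fun i => ?_
    rw [real_inner_comm (b i) x, sq]
  rw [← h.tsum_eq, ENNReal.ofReal_tsum_of_nonneg (fun i => sq_nonneg _) h.summable]

/-- A square-summable family of vectors and square-summable coefficients give an absolutely
convergent series, with the Cauchy-Schwarz bound. -/
theorem summable_smul_of_lp [CompleteSpace F] {ι : Type*} (a : lp (fun _ : ι => ℝ) 2)
    (f : lp (fun _ : ι => F) 2) :
    Summable (fun i => a i • f i) ∧ ‖∑' i, a i • f i‖ ≤ ‖a‖ * ‖f‖ := by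
  have hpq : (2 : ℝ).HolderConjugate 2 := Real.HolderConjugate.two_two
  have h2 : (0 : ℝ) < (2 : ℝ≥0∞).toReal := by norm_num
  have ha : Summable fun i => ‖a i‖ ^ (2 : ℝ) := by
    simpa using (memℓp_gen_iff h2).1 (lp.memℓp a)
  have hf : Summable fun i => ‖f i‖ ^ (2 : ℝ) := by
    simpa using (memℓp_gen_iff h2).1 (lp.memℓp f)
  have hs : Summable fun i => ‖a i • f i‖ := by
    simp only [norm_smul]
    exact Real.summable_mul_of_Lp_Lq_of_nonneg hpq (fun i => norm_nonneg _)
      (fun i => norm_nonneg _) ha hf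
  refine ⟨hs.of_norm, (norm_tsum_le_tsum_norm hs).trans ?_⟩
  have hb := Real.inner_le_Lp_mul_Lq_tsum_of_nonneg hpq (fun i => norm_nonneg (a i))
      (fun i => norm_nonneg (f i)) ha hf
  have hna : ‖a‖ = (∑' i, ‖a i‖ ^ (2 : ℝ)) ^ (1 / (2 : ℝ)) := by
    simpa using lp.norm_eq_tsum_rpow h2 a
  have hnf : ‖f‖ = (∑' i, ‖f i‖ ^ (2 : ℝ)) ^ (1 / (2 : ℝ)) := by
    simpa using lp.norm_eq_tsum_rpow h2 f
  rw [hna, hnf]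
  simpa only [norm_smul] using hb

variable [CompleteSpace E]

variable (E) in
/-- The index set of a fixed orthonormal (Hilbert) basis of `E`. -/
def OnbIndex : Set E := Classical.choose (exists_hilbertBasis ℝ E)

variable (E) in
/-- A fixed orthonormal (Hilbert) basis of `E`. The objects defined through it below do not depend
on this choice, see `summable_onb_iff` and `HilbertSchmidt.hasSum_inner`. -/
def onb : HilbertBasis (OnbIndex E) ℝ E :=
  Classical.choose (Classical.choose_spec (exists_hilbertBasis ℝ E))

theorem memℓp_two_iff {ι V : Type*} [NormedAddCommGroup V] (f : ι → V) :
    Memℓp f 2 ↔ Summable fun i => ‖f i‖ ^ 2 := by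
  rw [memℓp_gen_iff (by norm_num : (0 : ℝ) < (2 : ℝ≥0∞).toReal)]
  norm_num

/-- `∑ ‖G bᵢ‖²` is the same for all orthonormal bases `b` of `E`, and equal to `∑ ‖G* dⱼ‖²` for
all orthonormal bases `d` of `F`. -/
theorem tsum_norm_sq_eq [CompleteSpace F] {ι κ : Type*} (b : HilbertBasis ι ℝ E)
    (d : HilbertBasis κ ℝ F) (G : E →L[ℝ] F) :
    ∑' i, ENNReal.ofReal (‖G (b i)‖ ^ 2) =
      ∑' j, ENNReal.ofReal (‖ContinuousLinearMap.adjoint G (d j)‖ ^ 2) := by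
  have h1 : ∀ i, ENNReal.ofReal (‖G (b i)‖ ^ 2) =
      ∑' j, ENNReal.ofReal ((inner ℝ (d j) (G (b i))) ^ 2) :=
    fun i => (tsum_ofReal_inner_sq d _).symm
  have h2 : ∀ j, ENNReal.ofReal (‖ContinuousLinearMap.adjoint G (d j)‖ ^ 2) =
      ∑' i, ENNReal.ofReal ((inner ℝ (b i) (ContinuousLinearMap.adjoint G (d j))) ^ 2) :=
    fun j => (tsum_ofReal_inner_sq b _).symm
  simp_rw [h1, h2]
  rw [ENNReal.tsum_comm]
  refine tsum_congr fun j => tsum_congr fun i => ?_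
  rw [ContinuousLinearMap.adjoint_inner_right, real_inner_comm]

theorem summable_norm_sq_iff {ι V : Type*} [NormedAddCommGroup V] (f : ι → V) :
    (Summable fun i => ‖f i‖ ^ 2) ↔ ∑' i, ENNReal.ofReal (‖f i‖ ^ 2) ≠ ∞ := by
  constructor
  · exact fun h => h.tsum_ofReal_ne_top
  · intro h
    refine (ENNReal.summable_toReal h).congr fun i => ?_
    rw [ENNReal.toReal_ofReal (sq_nonneg _)]

theorem summable_onb_iff [CompleteSpace F] {ι : Type*} (b : HilbertBasis ι ℝ E)
    (G : E →L[ℝ] F) :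
    (Summable fun i => ‖G (onb E i)‖ ^ 2) ↔ Summable fun i => ‖G (b i)‖ ^ 2 := by
  rw [summable_norm_sq_iff, summable_norm_sq_iff, tsum_norm_sq_eq (onb E) (onb F),
    tsum_norm_sq_eq b (onb F)]

variable (E F) in
/-- The linear subspace of all bounded operators `G : E → F` with `∑ ‖G eᵢ‖² < ∞` for the
orthonormal basis `(eᵢ)` of `E`. -/
def hilbertSchmidtSubmodule : Submodule ℝ (E →L[ℝ] F) where
  carrier := {G | Summable fun i => ‖G (onb E i)‖ ^ 2}
  add_mem' := by
    intro G K hG hK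
    rw [Set.mem_ofPred_eq, ← memℓp_two_iff] at *
    exact hG.add hK
  zero_mem' := by simp
  smul_mem' := by
    intro c G hG
    rw [Set.mem_ofPred_eq, ← memℓp_two_iff] at *
    exact hG.const_smul c

variable (E F) in
/-- The space `𝓑₂(E; F)` of Hilbert-Schmidt operators from `E` to `F`, that is, of operators with
square-summable singular values. It is a type synonym, so that it carries the Hilbert-Schmidt norm
below and not the operator norm. -/
def HilbertSchmidt : Type _ := hilbertSchmidtSubmodule E F

namespace HilbertSchmidt

instance : AddCommGroup (HilbertSchmidt E F) :=
  inferInstanceAs (AddCommGroup (hilbertSchmidtSubmodule E F))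

instance : Module ℝ (HilbertSchmidt E F) :=
  inferInstanceAs (Module ℝ (hilbertSchmidtSubmodule E F))

/-- The bounded operator underlying a Hilbert-Schmidt operator. -/
def toCLM : HilbertSchmidt E F →ₗ[ℝ] E →L[ℝ] F := (hilbertSchmidtSubmodule E F).subtype

theorem toCLM_injective : Function.Injective (toCLM (E := E) (F := F)) :=
  Subtype.val_injective

theorem summable_onb (G : HilbertSchmidt E F) : Summable fun i => ‖G.toCLM (onb E i)‖ ^ 2 := G.2

/-- The linear map `G ↦ (G eᵢ)ᵢ` into `ℓ²`. -/
def toLp : HilbertSchmidt E F →ₗ[ℝ] lp (fun _ : OnbIndex E => F) 2 where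
  toFun G := ⟨fun i => G.toCLM (onb E i), (memℓp_two_iff _).2 G.summable_onb⟩
  map_add' G K := by ext i; simp; rfl
  map_smul' c G := by ext i; simp

theorem toLp_apply (G : HilbertSchmidt E F) (i : OnbIndex E) :
    toLp G i = G.toCLM (onb E i) := rfl

theorem toLp_injective : Function.Injective (toLp (E := E) (F := F)) := by
  intro G K h
  apply toCLM_injective
  refine ContinuousLinearMap.ext_on (s := Set.range (onb E)) ?_ ?_
  · have := (onb E).dense_span
    rw [Submodule.dense_iff_topologicalClosure_eq_top, this]
  · rintro _ ⟨i, rfl⟩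
    rw [← toLp_apply, ← toLp_apply, h]

/-- The Hilbert-Schmidt norm `‖G‖_HS = (∑ ‖G eᵢ‖²)^(1/2)`. -/
instance : NormedAddCommGroup (HilbertSchmidt E F) :=
  NormedAddCommGroup.induced (HilbertSchmidt E F) (lp (fun _ : OnbIndex E => F) 2) toLp
    toLp_injective

theorem norm_toLp (G : HilbertSchmidt E F) : ‖toLp G‖ = ‖G‖ := rfl

/-- The Hilbert-Schmidt inner product `⟪G, K⟫ = ∑ ⟪G eᵢ, K eᵢ⟫`. -/
instance : InnerProductSpace ℝ (HilbertSchmidt E F) where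
  norm_smul_le c G := by
    rw [← norm_toLp, ← norm_toLp, map_smul]
    exact norm_smul_le c (toLp G)
  inner G K := ∑' i, inner ℝ (G.toCLM (onb E i)) (K.toCLM (onb E i))
  norm_sq_eq_re_inner G := norm_sq_eq_re_inner (𝕜 := ℝ) (toLp G)
  conj_inner_symm G K := inner_conj_symm (𝕜 := ℝ) (toLp G) (toLp K)
  add_left G K L := by
    have := inner_add_left (𝕜 := ℝ) (toLp G) (toLp K) (toLp L)
    rwa [← map_add] at this
  smul_left G K c := by
    have := inner_smul_left (𝕜 := ℝ) (toLp G) (toLp K) c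
    rwa [← map_smul] at this

theorem inner_def (G K : HilbertSchmidt E F) :
    inner ℝ G K = ∑' i, inner ℝ (G.toCLM (onb E i)) (K.toCLM (onb E i)) := rfl

/-- The rank-one operator `u ⊗ v : a ↦ ⟪u, a⟫ v`, as a Hilbert-Schmidt operator. -/
def tensor (u : E) (v : F) : HilbertSchmidt E F :=
  ⟨InnerProductSpace.rankOne ℝ v u, by
    change Summable fun i => ‖InnerProductSpace.rankOne ℝ v u (onb E i)‖ ^ 2
    have h := ((onb E).summable_inner_mul_inner u u).mul_right (‖v‖ ^ 2)
    refine h.congr fun i => ?_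
    rw [InnerProductSpace.rankOne_apply, norm_smul, mul_pow, Real.norm_eq_abs, sq_abs,
      real_inner_comm u (onb E i), sq (inner ℝ u (onb E i))]⟩

theorem tensor_apply (u a : E) (v : F) : (tensor u v).toCLM a = inner ℝ u a • v :=
  InnerProductSpace.rankOne_apply v u a

variable [CompleteSpace F]

theorem toLp_surjective : Function.Surjective (toLp (E := E) (F := F)) := by
  classical
  intro f
  let L : E →ₗ[ℝ] F :=
    { toFun := fun x => ∑' i, (onb E).repr x i • f i
      map_add' := fun x y => by
        rw [← ((summable_smul_of_lp _ f).1).tsum_add ((summable_smul_of_lp _ f).1)]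
        refine tsum_congr fun i => ?_
        simp [add_smul]
      map_smul' := fun c x => by
        rw [RingHom.id_apply, ← ((summable_smul_of_lp _ f).1).tsum_const_smul c]
        refine tsum_congr fun i => ?_
        simp [mul_smul] }
  let G : E →L[ℝ] F := L.mkContinuous ‖f‖ fun x => by
    have := (summable_smul_of_lp ((onb E).repr x) f).2
    rw [LinearIsometryEquiv.norm_map, mul_comm] at this
    exact this
  have hG : ∀ i, G (onb E i) = f i := by
    intro i
    change ∑' j, (onb E).repr (onb E i) j • f j = f i
    rw [tsum_eq_single i]
    · simp [HilbertBasis.repr_apply_apply, (onb E).orthonormal.1 i]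
    · intro j hj
      simp [HilbertBasis.repr_apply_apply, (onb E).orthonormal.2 hj]
  refine ⟨⟨G, ?_⟩, ?_⟩
  · change Summable fun i => ‖G (onb E i)‖ ^ 2
    simp_rw [hG]
    exact (memℓp_two_iff _).1 (lp.memℓp f)
  · ext i
    exact hG i

instance : CompleteSpace (HilbertSchmidt E F) := by
  have hi : Isometry (toLp (E := E) (F := F)) := AddMonoidHomClass.isometry_of_norm _ norm_toLp
  exact (hi.isUniformInducing.completeSpace_congr toLp_surjective).2 inferInstance

/-- The Hilbert-Schmidt inner product does not depend on the orthonormal basis. -/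
theorem hasSum_inner {ι : Type*} (b : HilbertBasis ι ℝ E) (G K : HilbertSchmidt E F) :
    HasSum (fun i => inner ℝ (G.toCLM (b i)) (K.toCLM (b i))) (inner ℝ G K) := by
  have hn : ∀ L : HilbertSchmidt E F, HasSum (fun i => ‖L.toCLM (b i)‖ ^ 2) (‖L‖ ^ 2) := by
    intro L
    have hb : Summable fun i => ‖L.toCLM (b i)‖ ^ 2 := (summable_onb_iff b _).1 L.summable_onb
    have h0 : ‖L‖ ^ 2 = ∑' i, ‖L.toCLM (onb E i)‖ ^ 2 := by
      rw [← real_inner_self_eq_norm_sq, inner_def]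
      simp_rw [real_inner_self_eq_norm_sq]
    have h1 := (tsum_norm_sq_eq (onb E) (onb F) L.toCLM).trans
      (tsum_norm_sq_eq b (onb F) L.toCLM).symm
    rw [← ENNReal.ofReal_tsum_of_nonneg (fun i => sq_nonneg _) L.summable_onb,
      ← ENNReal.ofReal_tsum_of_nonneg (fun i => sq_nonneg _) hb,
      ENNReal.ofReal_eq_ofReal_iff (tsum_nonneg fun i => sq_nonneg _)
        (tsum_nonneg fun i => sq_nonneg _)] at h1
    rw [h0, h1]
    exact hb.hasSum
  have h := ((hn (G + K)).sub (hn (G - K))).div_const 4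
  have e : inner ℝ G K = (‖G + K‖ ^ 2 - ‖G - K‖ ^ 2) / 4 := by
    rw [norm_add_sq_real, norm_sub_sq_real]; ring
  rw [e]
  refine h.congr_fun fun i => ?_
  rw [map_add, map_sub, add_apply, sub_apply,
    norm_add_sq_real, norm_sub_sq_real]
  ring

theorem norm_toCLM_le (G : HilbertSchmidt E F) : ‖G.toCLM‖ ≤ ‖G‖ := by
  refine ContinuousLinearMap.opNorm_le_bound _ (norm_nonneg _) fun x => ?_
  have h := ((onb E).hasSum_repr x).mapL G.toCLM
  have h' := (summable_smul_of_lp ((onb E).repr x) (toLp G)).2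
  rw [LinearIsometryEquiv.norm_map, norm_toLp, mul_comm] at h'
  rw [← h.tsum_eq]
  simp only [map_smul]
  exact h'

/-- Hilbert-Schmidt operators are compact. -/
theorem isCompactOperator (G : HilbertSchmidt E F) : IsCompactOperator G.toCLM := by
  classical
  let A : (lp (fun _ : OnbIndex E => F) 2) →ₗ[ℝ] E →L[ℝ] F :=
    toCLM ∘ₗ (LinearEquiv.ofBijective toLp ⟨toLp_injective, toLp_surjective⟩).symm.toLinearMap
  have hA : ∀ K : HilbertSchmidt E F, A (toLp K) = K.toCLM := fun K =>
    congrArg toCLM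
      ((LinearEquiv.ofBijective toLp ⟨toLp_injective, toLp_surjective⟩).symm_apply_apply K)
  have hAn : ∀ f, ‖A f‖ ≤ 1 * ‖f‖ := by
    intro f
    obtain ⟨K, rfl⟩ := toLp_surjective f
    rw [hA, one_mul, norm_toLp]
    exact norm_toCLM_le K
  have hs := (lp.hasSum_single (p := 2) (by norm_num) (toLp G)).mapL (A.mkContinuous 1 hAn)
  refine isCompactOperator_of_tendsto (l := Filter.atTop) (f := G.toCLM) ?_
    (Filter.Eventually.of_forall fun t => ?_) (F := fun t : Finset (OnbIndex E) =>
      ∑ i ∈ t, InnerProductSpace.rankOne ℝ (toLp G i) (onb E i))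
  · have := hs
    rw [LinearMap.mkContinuous_apply, hA] at this
    refine (this : Filter.Tendsto _ _ _).congr fun t => Finset.sum_congr rfl fun i _ => ?_
    have h1 : toLp (tensor (onb E i) (toLp G i)) = lp.single 2 i (toLp G i) := by
      ext j
      rw [toLp_apply, tensor_apply, lp.coeFn_single]
      by_cases hij : j = i
      · subst hij
        simp [(onb E).orthonormal.1 j]
      · simp [(onb E).orthonormal.2 (Ne.symm hij), hij]
    change A (lp.single 2 i (toLp G i)) = _
    rw [← h1, hA]
    rfl
  · have : ∀ i, IsCompactOperator (InnerProductSpace.rankOne ℝ (toLp G i) (onb E i)) := by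
      intro i
      rw [InnerProductSpace.rankOne_def']
      exact (isCompactOperator_of_locallyCompactSpace_rng
        (ContinuousLinearMap.toSpanSingleton ℝ (toLp G i))).comp_clm (innerSL ℝ (onb E i))
    induction t using Finset.induction_on with
    | empty => simpa using isCompactOperator_zero
    | insert i t hi ih =>
      rw [Finset.sum_insert hi]
      exact (this i).add ih

/-- The multiplicity of `s > 0` as a singular value of `G`, that is, the multiplicity of `s²` as an
eigenvalue of `G* G`. It is finite, see `finiteDimensional_eigenspace`. -/
def singularValueMultiplicity (G : HilbertSchmidt E F) (s : ℝ≥0) : ℕ :=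
  Module.finrank ℝ (Module.End.eigenspace
    ((ContinuousLinearMap.adjoint G.toCLM ∘L G.toCLM : E →L[ℝ] E) : Module.End ℝ E)
    ((s : ℝ) ^ 2))

theorem finiteDimensional_eigenspace (G : HilbertSchmidt E F) {s : ℝ≥0} (hs : s ≠ 0) :
    FiniteDimensional ℝ (Module.End.eigenspace
      ((ContinuousLinearMap.adjoint G.toCLM ∘L G.toCLM : E →L[ℝ] E) : Module.End ℝ E)
      ((s : ℝ) ^ 2)) :=
  ContinuousLinearMap.finite_dimensional_eigenspace (G.isCompactOperator.clm_comp (ContinuousLinearMap.adjoint G.toCLM)) _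
    (pow_ne_zero 2 (NNReal.coe_ne_zero.2 hs))

/-- The nuclear norm `‖G‖_* ∈ [0, ∞]`: the sum of the singular values of `G`, repeated according to
their multiplicity. (The term of `s = 0` vanishes.) -/
def nuclearNorm (G : HilbertSchmidt E F) : ℝ≥0∞ :=
  ∑' s : ℝ≥0, (G.singularValueMultiplicity s : ℝ≥0∞) * (s : ℝ≥0∞)

end HilbertSchmidt

end HilbertSchmidt

section Recovery

variable {N : ℕ} {H₁ H₂ H : Type*}
  [NormedAddCommGroup H₁] [InnerProductSpace ℝ H₁] [CompleteSpace H₁]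
  [NormedAddCommGroup H₂] [InnerProductSpace ℝ H₂] [CompleteSpace H₂]
  [NormedAddCommGroup H] [InnerProductSpace ℝ H] [CompleteSpace H]

variable (N H₁ H₂) in
/-- The Hilbert space `𝓑₂(H₁; H₂)^N`. -/
abbrev HSPow : Type _ := PiLp 2 (fun _ : Fin N => HilbertSchmidt H₁ H₂)

/-- The objective `F ↦ ½ ‖Φ F - w‖² + lam ∑ᵢ ‖Fᵢ‖_*`, with values in `[0, ∞]`. -/
def regObjective (Φ : HSPow N H₁ H₂ →L[ℝ] H) (w : H) (lam : ℝ) (F : HSPow N H₁ H₂) : ℝ≥0∞ :=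
  ENNReal.ofReal (1 / 2 * ‖Φ F - w‖ ^ 2) + ENNReal.ofReal lam * ∑ i, (F i).nuclearNorm

/-- `F` minimizes `½ ‖Φ F - w‖² + lam ∑ᵢ ‖Fᵢ‖_*` over `𝓑₂(H₁; H₂)^N`. -/
def IsRegMinimizer (Φ : HSPow N H₁ H₂ →L[ℝ] H) (w : H) (lam : ℝ) (F : HSPow N H₁ H₂) : Prop :=
  ∀ G : HSPow N H₁ H₂, regObjective Φ w lam F ≤ regObjective Φ w lam G

/-- The tuple `(σᵢ uᵢ ⊗ vᵢ)ᵢ` of rank-one operators. -/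
def rankOneTuple (σ : Fin N → ℝ) (u : Fin N → H₁) (v : Fin N → H₂) : HSPow N H₁ H₂ :=
  WithLp.toLp 2 fun i => σ i • HilbertSchmidt.tensor (u i) (v i)

/-- The model tangent space `T = ∏ᵢ {uᵢ ⊗ a + b ⊗ vᵢ : a ∈ H₂, b ∈ H₁}`. -/
def tangentSpace (u : Fin N → H₁) (v : Fin N → H₂) : Set (HSPow N H₁ H₂) :=
  {F | ∀ i, ∃ (a : H₂) (b : H₁),
    F i = HilbertSchmidt.tensor (u i) a + HilbertSchmidt.tensor b (v i)}

/-- The non-degenerate source condition: some `K` in the range of `Φ*` satisfies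
`Kᵢ = uᵢ ⊗ vᵢ + Wᵢ` with `Wᵢ uᵢ = 0`, `Wᵢ* vᵢ = 0` and operator norm `‖Wᵢ‖ < 1`, for all `i`. -/
def NonDegenerateSourceCondition (Φ : HSPow N H₁ H₂ →L[ℝ] H) (u : Fin N → H₁)
    (v : Fin N → H₂) : Prop :=
  ∃ K ∈ Set.range (ContinuousLinearMap.adjoint Φ), ∀ i, ∃ W : HilbertSchmidt H₁ H₂,
    K i = HilbertSchmidt.tensor (u i) (v i) + W ∧ W.toCLM (u i) = 0 ∧
      ContinuousLinearMap.adjoint W.toCLM (v i) = 0 ∧ ‖W.toCLM‖ < 1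

end Recovery

end NuclearRecovery

end

/-!
The proof rests on a lower bound for the nuclear norm. By trace duality
(`ofReal_inner_le_nuclearNorm`), `⟪M, G⟫ ≤ ‖G‖_*` whenever `‖M‖ ≤ 1`; this follows by expanding both
sides in an orthonormal basis of eigenvectors of the compact operator `G* G`. Let `G` be a
Hilbert-Schmidt operator with normal component `Q` at `u ⊗ v`, that is, `G = u ⊗ a + b ⊗ v + Q` with
`Q u = 0` and `Q* v = 0`, and let `W` satisfy `W u = 0`, `W* v = 0` and `‖W‖ < 1`. Then
`M = u ⊗ v + W + (1 - ‖W‖) Q / ‖Q‖_HS` is still a contraction, and duality gives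
`‖G‖_* ≥ ⟪u ⊗ v + W, G⟫ + (1 - ‖W‖) ‖Q‖_HS`
(`ofReal_inner_add_norm_normal_le_nuclearNorm`).

Write `K = Φ* p` for the element of the source condition. Comparing the objective at the minimizer
`F` with that at the exact solution `F†`, and inserting the lower bound, gives
`½ r² + λ S ≤ ½ δ² + λ ‖p‖ (r + δ)`, where `r` is the residual of `F` and `S` is the weighted sum of
the norms of the normal components of `F`. With `λ = c δ` this forces `r = O(δ)` and `S = O(δ)`
(`residual_and_bregman_le`). So the normal part of the error `F - F†` is `O(δ)`. The tangent space
is closed, being an orthogonal complement, hence `Φ` is bounded below on it by the open mapping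
theorem (`exists_norm_le_of_mem_tangentSpace`), and the tangential part of the error is bounded by
its image under `Φ`, which is `O(δ)` as well (`sum_norm_sub_le`).
-/

open scoped ENNReal NNReal

noncomputable section

namespace NuclearRecovery

/-! ### Trace duality -/

section Duality

variable {E F : Type*} [NormedAddCommGroup E] [InnerProductSpace ℝ E] [CompleteSpace E]
  [NormedAddCommGroup F] [InnerProductSpace ℝ F] [CompleteSpace F]

namespace HilbertSchmidt

/-- The operator `G* G`, whose eigenvalues are the squares of the singular values of `G`. -/
abbrev gram (G : HilbertSchmidt E F) : E →L[ℝ] E :=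
  ContinuousLinearMap.adjoint G.toCLM ∘L G.toCLM

theorem gram_isSymmetric (G : HilbertSchmidt E F) : G.gram.IsSymmetric := fun x y => by
  simp [gram, ContinuousLinearMap.adjoint_inner_left, ContinuousLinearMap.adjoint_inner_right]

theorem isCompactOperator_gram (G : HilbertSchmidt E F) : IsCompactOperator G.gram :=
  G.isCompactOperator.clm_comp (ContinuousLinearMap.adjoint G.toCLM)

/-- The space of right singular vectors of `G` for the singular value `s`. -/
abbrev singularSpace (G : HilbertSchmidt E F) (s : ℝ≥0) : Submodule ℝ E :=
  Module.End.eigenspace (G.gram : Module.End ℝ E) ((s : ℝ) ^ 2)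

theorem mem_singularSpace {G : HilbertSchmidt E F} {s : ℝ≥0} {x : E} :
    x ∈ G.singularSpace s ↔
      ContinuousLinearMap.adjoint G.toCLM (G.toCLM x) = (s : ℝ) ^ 2 • x :=
  Module.End.mem_eigenspace_iff

instance (G : HilbertSchmidt E F) (s : ℝ≥0) : CompleteSpace (G.singularSpace s) := by
  have h : IsClosed (G.singularSpace s : Set E) := by
    have : (G.singularSpace s : Set E) =
        {x | ContinuousLinearMap.adjoint G.toCLM (G.toCLM x) = (s : ℝ) ^ 2 • x} :=
      Set.ext fun x => mem_singularSpace
    rw [this]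
    exact isClosed_eq (by fun_prop) (by fun_prop)
  exact h.completeSpace_coe

theorem norm_apply_of_mem_singularSpace {G : HilbertSchmidt E F} {s : ℝ≥0} {x : E}
    (hx : x ∈ G.singularSpace s) : ‖G.toCLM x‖ = s * ‖x‖ := by
  have h : ‖G.toCLM x‖ ^ 2 = (s * ‖x‖) ^ 2 := by
    rw [← real_inner_self_eq_norm_sq, ← ContinuousLinearMap.adjoint_inner_left,
      mem_singularSpace.1 hx, real_inner_smul_left, real_inner_self_eq_norm_sq, mul_pow]
  exact (pow_left_inj₀ (norm_nonneg _) (by positivity) two_ne_zero).1 h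

/-- A nonzero eigenvector of `G* G` has a nonnegative eigenvalue, so the spaces `singularSpace`
exhaust all eigenspaces. -/
theorem orthogonal_iSup_singularSpace (G : HilbertSchmidt E F) : (⨆ s, G.singularSpace s)ᗮ = ⊥ := by
  rw [eq_bot_iff, ← ContinuousLinearMap.orthogonalComplement_iSup_eigenspaces_eq_bot
    G.isCompactOperator_gram G.gram_isSymmetric]
  refine Submodule.orthogonal_le (iSup_le fun μ x hx => ?_)
  by_cases hx0 : x = 0
  · rw [hx0]; exact zero_mem _
  have hμ : 0 ≤ μ := by
    have h1 : ‖G.toCLM x‖ ^ 2 = μ * ‖x‖ ^ 2 := by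
      have h2 : ContinuousLinearMap.adjoint G.toCLM (G.toCLM x) = μ • x :=
        Module.End.mem_eigenspace_iff.1 hx
      rw [← real_inner_self_eq_norm_sq, ← ContinuousLinearMap.adjoint_inner_left, h2,
        real_inner_smul_left, real_inner_self_eq_norm_sq]
    have h3 : 0 < ‖x‖ ^ 2 := by positivity
    by_contra! hneg
    nlinarith [sq_nonneg ‖G.toCLM x‖]
  refine Submodule.mem_iSup_of_mem (√μ).toNNReal ?_
  rw [mem_singularSpace, Real.coe_toNNReal _ (Real.sqrt_nonneg μ), Real.sq_sqrt hμ]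
  exact Module.End.mem_eigenspace_iff.1 hx

/-- An orthonormal basis of right singular vectors of `G`, from the spectral theorem for the
compact self-adjoint operator `G* G`. -/
theorem exists_hilbertBasis_singular (G : HilbertSchmidt E F) :
    ∃ b : HilbertBasis (Σ s : ℝ≥0, OnbIndex (G.singularSpace s)) ℝ E,
      ∀ i, b i ∈ G.singularSpace i.1 := by
  have hV : OrthogonalFamily ℝ (fun s : ℝ≥0 => G.singularSpace s)
      fun s => (G.singularSpace s).subtypeₗᵢ :=
    (G.gram_isSymmetric.orthogonalFamily_eigenspaces).comp (f := fun s : ℝ≥0 => (s : ℝ) ^ 2)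
      fun s t h => NNReal.coe_injective
        ((pow_left_inj₀ s.coe_nonneg t.coe_nonneg two_ne_zero).1 h)
  have ho := hV.orthonormal_sigma_orthonormal fun s => (onb (G.singularSpace s)).orthonormal
  refine ⟨HilbertBasis.mkOfOrthogonalEqBot ho ?_, fun i => ?_⟩
  · rw [eq_bot_iff, ← G.orthogonal_iSup_singularSpace]
    intro x hx
    rw [← Submodule.iInf_orthogonal, Submodule.mem_iInf]
    refine fun s => (Submodule.mem_orthogonal _ _).2 fun y hy => ?_
    -- `y` is the sum of its basis expansion, and `x` is orthogonal to each term of it.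
    have h := (((onb (G.singularSpace s)).hasSum_repr ⟨y, hy⟩).mapL
      (G.singularSpace s).subtypeL).mapL (innerSL ℝ x)
    rw [real_inner_comm]
    refine h.unique (hasSum_zero.congr_fun fun j => ?_)
    have hj : inner ℝ x ((onb (G.singularSpace s) j : G.singularSpace s) : E) = 0 :=
      Submodule.inner_left_of_mem_orthogonal
        (Submodule.subset_span (Set.mem_range.2 ⟨⟨s, j⟩, rfl⟩)) hx
    simp [hj]
  · rw [HilbertBasis.coe_mkOfOrthogonalEqBot]
    exact Subtype.property _

theorem tsum_onbIndex_singularSpace_le (G : HilbertSchmidt E F) (s : ℝ≥0) :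
    ∑' _ : OnbIndex (G.singularSpace s), (s : ℝ≥0∞) ≤
      (G.singularValueMultiplicity s : ℝ≥0∞) * (s : ℝ≥0∞) := by
  rcases eq_or_ne s 0 with rfl | hs
  · simp
  have := G.finiteDimensional_eigenspace hs
  have hl := (onb (G.singularSpace s)).orthonormal.linearIndependent
  have := hl.finite
  have := Fintype.ofFinite (OnbIndex (G.singularSpace s))
  rw [tsum_fintype, Finset.sum_const, nsmul_eq_mul]
  gcongr
  exact hl.fintype_card_le_finrank

/-- Trace duality: the nuclear norm dominates every functional `⟪M, ·⟫` with `‖M‖ ≤ 1`. Both sides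
are expanded in an orthonormal basis of right singular vectors. -/
theorem ofReal_inner_le_nuclearNorm (G M : HilbertSchmidt E F) (hM : ‖M.toCLM‖ ≤ 1) :
    ENNReal.ofReal (inner ℝ M G) ≤ G.nuclearNorm := by
  obtain ⟨b, hb⟩ := G.exists_hilbertBasis_singular
  have hterm : ∀ i, inner ℝ (M.toCLM (b i)) (G.toCLM (b i)) ≤ i.1 := fun i => by
    have h1 : ‖b i‖ = 1 := b.orthonormal.1 i
    have h2 : ‖M.toCLM (b i)‖ ≤ 1 := by simpa [h1] using M.toCLM.le_of_opNorm_le hM (b i)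
    calc inner ℝ (M.toCLM (b i)) (G.toCLM (b i)) ≤ ‖M.toCLM (b i)‖ * ‖G.toCLM (b i)‖ :=
          real_inner_le_norm _ _
      _ ≤ 1 * ‖G.toCLM (b i)‖ := by gcongr
      _ = i.1 := by rw [norm_apply_of_mem_singularSpace (hb i), h1, one_mul, mul_one]
  calc ENNReal.ofReal (inner ℝ M G) ≤ ∑' i : Σ s : ℝ≥0, OnbIndex (G.singularSpace s),
        (i.1 : ℝ≥0∞) := by
        refine le_of_tendsto' ((ENNReal.continuous_ofReal.tendsto _).comp (hasSum_inner b M G))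
          fun t => le_trans ?_ (ENNReal.sum_le_tsum t)
        calc ENNReal.ofReal (∑ i ∈ t, inner ℝ (M.toCLM (b i)) (G.toCLM (b i)))
            ≤ ENNReal.ofReal (∑ i ∈ t, (i.1 : ℝ)) :=
              ENNReal.ofReal_le_ofReal (Finset.sum_le_sum fun i _ => hterm i)
          _ = ∑ i ∈ t, (i.1 : ℝ≥0∞) := by
              rw [ENNReal.ofReal_sum_of_nonneg fun i _ => i.1.coe_nonneg]
              simp
    _ = ∑' s : ℝ≥0, ∑' _ : OnbIndex (G.singularSpace s), (s : ℝ≥0∞) :=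
        ENNReal.tsum_sigma' _
    _ ≤ G.nuclearNorm := ENNReal.tsum_le_tsum G.tsum_onbIndex_singularSpace_le

/-! ### Rank-one operators -/

theorem inner_tensor_left (u : E) (v : F) (G : HilbertSchmidt E F) :
    inner ℝ (tensor u v) G = inner ℝ v (G.toCLM u) := by
  rw [← ContinuousLinearMap.adjoint_inner_left, real_inner_comm u]
  refine (hasSum_inner (onb E) _ G).unique
    (((onb E).hasSum_inner_mul_inner u (ContinuousLinearMap.adjoint G.toCLM v)).congr_fun
      fun i => ?_)
  rw [tensor_apply, real_inner_smul_left, ContinuousLinearMap.adjoint_inner_right,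
    real_inner_comm v]

theorem adjoint_tensor_apply (u : E) (v y : F) :
    ContinuousLinearMap.adjoint (tensor u v).toCLM y = inner ℝ v y • u := by
  refine ext_inner_right ℝ fun x => ?_
  rw [ContinuousLinearMap.adjoint_inner_left, tensor_apply, real_inner_smul_right,
    real_inner_smul_left, real_inner_comm y v, mul_comm]

/-- The only nonzero singular value of `σ u ⊗ v` is `σ`, with multiplicity one. -/
theorem nuclearNorm_smul_tensor_le {σ : ℝ} (hσ : 0 < σ) {u : E} (hu : ‖u‖ = 1) {v : F}
    (hv : ‖v‖ = 1) : (σ • tensor u v).nuclearNorm ≤ ENNReal.ofReal σ := by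
  have hmem : ∀ (s : ℝ≥0) (x : E), x ∈ (σ • tensor u v).singularSpace s →
      (σ ^ 2 * inner ℝ u x) • u = (s : ℝ) ^ 2 • x := fun s x hx => by
    rw [← mem_singularSpace.1 hx, map_smul, map_smul, smul_apply,
      smul_apply, adjoint_tensor_apply, tensor_apply]
    simp only [inner_smul_right, real_inner_self_eq_norm_sq, hv, smul_smul]
    congr 1
    ring
  have hne : ∀ s : ℝ≥0, s ≠ σ.toNNReal →
      ((σ • tensor u v).singularValueMultiplicity s : ℝ≥0∞) * (s : ℝ≥0∞) = 0 := by
    intro s hs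
    rcases eq_or_ne s 0 with rfl | hs0
    · simp
    have hbot : (σ • tensor u v).singularSpace s = ⊥ := by
      refine (Submodule.eq_bot_iff _).2 fun x hx => ?_
      have h1 := hmem s x hx
      have h2 : σ ^ 2 * inner ℝ u x = (s : ℝ) ^ 2 * inner ℝ u x := by
        have := congrArg (inner ℝ u) h1
        simpa [inner_smul_right, real_inner_self_eq_norm_sq, hu] using this
      have h3 : inner ℝ u x = 0 := by
        by_contra h
        have h4 := (pow_left_inj₀ hσ.le s.coe_nonneg two_ne_zero).1 (mul_right_cancel₀ h h2)
        exact hs (by rw [h4, Real.toNNReal_coe])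
      rw [h3, mul_zero, zero_smul] at h1
      exact (smul_eq_zero.1 h1.symm).resolve_left (pow_ne_zero 2 (NNReal.coe_ne_zero.2 hs0))
    have : (σ • tensor u v).singularValueMultiplicity s = 0 := by
      change Module.finrank ℝ ((σ • tensor u v).singularSpace s) = 0
      rw [hbot, finrank_bot]
    rw [this, Nat.cast_zero, zero_mul]
  rw [nuclearNorm, tsum_eq_single _ hne]
  have h1 : (σ • tensor u v).singularValueMultiplicity σ.toNNReal ≤ 1 := by
    have hle : (σ • tensor u v).singularSpace σ.toNNReal ≤ Submodule.span ℝ {u} := fun x hx => by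
      have h := hmem _ x hx
      rw [mul_smul, Real.coe_toNNReal σ hσ.le] at h
      rw [← smul_right_injective E (pow_ne_zero 2 hσ.ne') h]
      exact Submodule.smul_mem _ _ (Submodule.mem_span_singleton_self u)
    exact (Submodule.finrank_mono hle).trans (by simpa using finrank_span_le_card ({u} : Set E))
  calc _ ≤ (1 : ℝ≥0∞) * (σ.toNNReal : ℝ≥0∞) := by
        gcongr
        exact_mod_cast h1
    _ = ENNReal.ofReal σ := one_mul _

end HilbertSchmidt

end Duality

/-! ### Tangent and normal directions at a rank-one operator -/

section Normal

variable {E F : Type*} [NormedAddCommGroup E] [InnerProductSpace ℝ E] [CompleteSpace E]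
  [NormedAddCommGroup F] [InnerProductSpace ℝ F] [CompleteSpace F]

namespace HilbertSchmidt

/-- The normal space at `u ⊗ v`: the operators `Q` with `Q u = 0` and `Q* v = 0`. -/
def normalSpace (u : E) (v : F) : Submodule ℝ (HilbertSchmidt E F) where
  carrier := {Q | Q.toCLM u = 0 ∧ ContinuousLinearMap.adjoint Q.toCLM v = 0}
  add_mem' := by
    rintro Q R ⟨hQ, hQ'⟩ ⟨hR, hR'⟩
    exact ⟨by simp [hQ, hR], by simp [hQ', hR']⟩
  zero_mem' := ⟨by simp, by simp⟩
  smul_mem' := by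
    rintro c Q ⟨hQ, hQ'⟩
    exact ⟨by simp [hQ], by simp [hQ']⟩

theorem inner_tangent_normal {u : E} {v : F} {Q : HilbertSchmidt E F}
    (hQ : Q ∈ normalSpace u v) (a : F) (b : E) :
    inner ℝ (tensor u a + tensor b v) Q = 0 := by
  rw [inner_add_left, inner_tensor_left, inner_tensor_left, hQ.1, inner_zero_right,
    ← ContinuousLinearMap.adjoint_inner_left, hQ.2, inner_zero_left, add_zero]

theorem exists_eq_tangent_add_normal {u : E} (hu : ‖u‖ = 1) {v : F} (hv : ‖v‖ = 1)
    (G : HilbertSchmidt E F) :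
    ∃ (a : F) (b : E), ∃ Q ∈ normalSpace u v, G = tensor u a + tensor b v + Q := by
  have huu : inner ℝ u u = 1 := by rw [real_inner_self_eq_norm_sq, hu, one_pow]
  have hvv : inner ℝ v v = 1 := by rw [real_inner_self_eq_norm_sq, hv, one_pow]
  -- The second term of `b` keeps the component `⟪v, G u⟫ u ⊗ v` from being counted twice.
  let b : E := ContinuousLinearMap.adjoint G.toCLM v - (inner ℝ v (G.toCLM u) : ℝ) • u
  refine ⟨G.toCLM u, b, G - (tensor u (G.toCLM u) + tensor b v), ⟨?_, ?_⟩, by abel⟩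
  · have hb : (inner ℝ b u : ℝ) = 0 := by
      rw [inner_sub_left, ContinuousLinearMap.adjoint_inner_left, real_inner_smul_left, huu,
        mul_one, sub_self]
    simp only [map_sub, map_add, sub_apply, add_apply, tensor_apply, huu, hb, one_smul, zero_smul,
      add_zero, sub_self]
  · simp only [map_sub, map_add, sub_apply, add_apply, adjoint_tensor_apply, hvv, one_smul]
    rw [real_inner_comm v]
    simp only [b]
    abel

theorem mem_orthogonal_normalSpace_iff {u : E} (hu : ‖u‖ = 1) {v : F} (hv : ‖v‖ = 1)
    {G : HilbertSchmidt E F} :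
    G ∈ (normalSpace u v)ᗮ ↔ ∃ (a : F) (b : E), G = tensor u a + tensor b v := by
  constructor
  · intro hG
    obtain ⟨a, b, Q, hQ, h⟩ := exists_eq_tangent_add_normal hu hv G
    have h0 : inner ℝ G Q = 0 := Submodule.inner_left_of_mem_orthogonal hQ hG
    rw [h, inner_add_left, inner_tangent_normal hQ, zero_add, inner_self_eq_zero] at h0
    exact ⟨a, b, by rw [h, h0, add_zero]⟩
  · rintro ⟨a, b, rfl⟩
    exact (Submodule.mem_orthogonal' _ _).2 fun Q hQ => inner_tangent_normal hQ a b

theorem tensor_mem_orthogonal_normalSpace (u : E) (v : F) :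
    tensor u v ∈ (normalSpace u v)ᗮ :=
  (Submodule.mem_orthogonal' _ _).2 fun Q hQ => by
    rw [inner_tensor_left, hQ.1, inner_zero_right]

/-- `u ⊗ v + W` is a contraction, because its two summands have orthogonal supports and orthogonal
ranges. -/
theorem norm_toCLM_tensor_add_le_one {u : E} (hu : ‖u‖ = 1) {v : F} (hv : ‖v‖ = 1)
    {W : HilbertSchmidt E F} (hW : W ∈ normalSpace u v) (hW1 : ‖W.toCLM‖ ≤ 1) :
    ‖(tensor u v + W).toCLM‖ ≤ 1 := by
  refine ContinuousLinearMap.opNorm_le_bound _ zero_le_one fun x => ?_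
  rw [one_mul]
  set s : ℝ := inner ℝ u x with hs
  set y : E := x - s • u with hy
  have hWx : W.toCLM x = W.toCLM y := by rw [hy, map_sub, map_smul, hW.1, smul_zero, sub_zero]
  have h1 : (tensor u v + W).toCLM x = s • v + W.toCLM y := by
    rw [map_add, add_apply, tensor_apply, hWx]
  have h2 : inner ℝ (s • v) (W.toCLM y) = 0 := by
    rw [real_inner_smul_left, ← ContinuousLinearMap.adjoint_inner_left, hW.2, inner_zero_left,
      mul_zero]
  have h3 : inner ℝ (s • u) y = 0 := by
    rw [hy, inner_sub_right, real_inner_smul_left, real_inner_smul_left, real_inner_smul_right,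
      real_inner_self_eq_norm_sq, hu, ← hs]
    ring
  have h4 : ‖W.toCLM y‖ ≤ ‖y‖ := by simpa using W.toCLM.le_of_opNorm_le hW1 y
  have h5 : x = s • u + y := by rw [hy]; abel
  refine (pow_le_pow_iff_left₀ (norm_nonneg _) (norm_nonneg _) two_ne_zero).1 ?_
  rw [h1, norm_add_sq_real, h2, h5, norm_add_sq_real, h3, norm_smul, norm_smul, hu, hv]
  gcongr

/-- A non-degenerate subgradient `u ⊗ v + W` leaves room to move by `(1 - ‖W‖) Q / ‖Q‖` inside
the unit ball of the operator norm, so the Bregman distance controls the normal component `Q`. -/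
theorem ofReal_inner_add_norm_normal_le_nuclearNorm {u : E} (hu : ‖u‖ = 1) {v : F}
    (hv : ‖v‖ = 1) {W : HilbertSchmidt E F} (hW : W ∈ normalSpace u v) (hW1 : ‖W.toCLM‖ ≤ 1)
    {G Q : HilbertSchmidt E F} (hQ : Q ∈ normalSpace u v) {a : F} {b : E}
    (hG : G = tensor u a + tensor b v + Q) :
    ENNReal.ofReal (inner ℝ (tensor u v + W) G + (1 - ‖W.toCLM‖) * ‖Q‖) ≤ G.nuclearNorm := by
  -- For `Q = 0` the coefficient `t` is `0`, and the argument still applies.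
  set t : ℝ := (1 - ‖W.toCLM‖) / ‖Q‖ with ht
  have ht0 : 0 ≤ t := div_nonneg (sub_nonneg.2 hW1) (norm_nonneg _)
  have htQ : t * ‖Q‖ ≤ 1 - ‖W.toCLM‖ := by
    rcases eq_or_ne ‖Q‖ 0 with h | h
    · rw [h, mul_zero]; exact sub_nonneg.2 hW1
    · rw [ht, div_mul_cancel₀ _ h]
  have hn : ‖(W + t • Q).toCLM‖ ≤ 1 := by
    rw [map_add, map_smul]
    calc ‖W.toCLM + t • Q.toCLM‖ ≤ ‖W.toCLM‖ + t * ‖Q.toCLM‖ := by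
          refine (norm_add_le _ _).trans_eq ?_
          rw [norm_smul, Real.norm_of_nonneg ht0]
      _ ≤ ‖W.toCLM‖ + t * ‖Q‖ := by gcongr; exact norm_toCLM_le Q
      _ ≤ 1 := by linarith
  have hQG : inner ℝ Q G = ‖Q‖ ^ 2 := by
    rw [real_inner_comm, hG, inner_add_left, inner_tangent_normal hQ, zero_add,
      real_inner_self_eq_norm_sq]
  have key := ofReal_inner_le_nuclearNorm G (tensor u v + (W + t • Q))
    (norm_toCLM_tensor_add_le_one hu hv (add_mem hW (Submodule.smul_mem _ t hQ)) hn)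
  have e : t * ‖Q‖ ^ 2 = (1 - ‖W.toCLM‖) * ‖Q‖ := by
    rcases eq_or_ne ‖Q‖ 0 with h | h
    · simp [h]
    · rw [ht]; field_simp
  rwa [← add_assoc, inner_add_left, real_inner_smul_left, hQG, e] at key

end HilbertSchmidt

end Normal

section Recovery

variable {N : ℕ} {H₁ H₂ H : Type*}
  [NormedAddCommGroup H₁] [InnerProductSpace ℝ H₁] [CompleteSpace H₁]
  [NormedAddCommGroup H₂] [InnerProductSpace ℝ H₂] [CompleteSpace H₂]
  [NormedAddCommGroup H] [InnerProductSpace ℝ H] [CompleteSpace H]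

open HilbertSchmidt

/-- The model tangent space `T`, described as the orthogonal complement of the normal directions,
which makes it a closed subspace. -/
def tangentSubmodule (u : Fin N → H₁) (v : Fin N → H₂) : Submodule ℝ (HSPow N H₁ H₂) where
  carrier := {F | ∀ i, F i ∈ (normalSpace (u i) (v i))ᗮ}
  add_mem' hF hG i := add_mem (hF i) (hG i)
  zero_mem' _ := zero_mem _
  smul_mem' c _ hF i := Submodule.smul_mem _ c (hF i)

theorem coe_tangentSubmodule {u : Fin N → H₁} (hu : ∀ i, ‖u i‖ = 1) {v : Fin N → H₂}
    (hv : ∀ i, ‖v i‖ = 1) : (tangentSubmodule u v : Set (HSPow N H₁ H₂)) = tangentSpace u v :=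
  Set.ext fun _ => forall_congr' fun i => mem_orthogonal_normalSpace_iff (hu i) (hv i)

theorem isClosed_tangentSubmodule (u : Fin N → H₁) (v : Fin N → H₂) :
    IsClosed (tangentSubmodule u v : Set (HSPow N H₁ H₂)) := by
  have h : (tangentSubmodule u v : Set (HSPow N H₁ H₂)) =
      ⋂ i, (fun F : HSPow N H₁ H₂ => F i) ⁻¹' ((normalSpace (u i) (v i))ᗮ : Set _) := by
    ext F
    rw [Set.mem_iInter]
    rfl
  rw [h]
  exact isClosed_iInter fun i =>
    (Submodule.isClosed_orthogonal _).preimage (PiLp.continuous_apply 2 _ i)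

/-- By the open mapping theorem `Φ` is bounded below on the tangent space. -/
theorem exists_norm_le_of_mem_tangentSpace (Φ : HSPow N H₁ H₂ →L[ℝ] H)
    {u : Fin N → H₁} (hu : ∀ i, ‖u i‖ = 1) {v : Fin N → H₂} (hv : ∀ i, ‖v i‖ = 1)
    (hinj : Set.InjOn Φ (tangentSpace u v)) (hclosed : IsClosed (Φ '' tangentSpace u v)) :
    ∃ A : ℝ≥0, ∀ F ∈ tangentSpace u v, ‖F‖ ≤ A * ‖Φ F‖ := by
  rw [← coe_tangentSubmodule hu hv] at *
  have := (isClosed_tangentSubmodule u v).completeSpace_coe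
  obtain ⟨A, hA⟩ := ContinuousLinearMap.antilipschitz_of_injective_of_isClosed_range
    (Φ.comp (tangentSubmodule u v).subtypeL)
    (fun x y h => Subtype.ext (hinj x.2 y.2 h))
    (by
      have : Set.range (Φ.comp (tangentSubmodule u v).subtypeL) =
          Φ '' (tangentSubmodule u v : Set (HSPow N H₁ H₂)) := by
        ext z
        simp
      rwa [this])
  exact ⟨A, fun F hF => (hA.le_mul_norm_sub ⟨F, hF⟩ 0).trans_eq' (by simp) |>.trans_eq (by simp)⟩

end Recovery

/-! ### The linear convergence rate -/

section Rate

variable {N : ℕ} {H₁ H₂ H : Type*}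
  [NormedAddCommGroup H₁] [InnerProductSpace ℝ H₁] [CompleteSpace H₁]
  [NormedAddCommGroup H₂] [InnerProductSpace ℝ H₂] [CompleteSpace H₂]
  [NormedAddCommGroup H] [InnerProductSpace ℝ H]

open HilbertSchmidt

/-- Comparison of a minimizer `F` with a competitor `G`, in real numbers: the nuclear norms are
replaced by lower bounds `l` for `F` and upper bounds `τ` for `G`. -/
theorem IsRegMinimizer.objective_le {Φ : HSPow N H₁ H₂ →L[ℝ] H} {w : H} {lam : ℝ}
    (hlam : 0 ≤ lam) {F G : HSPow N H₁ H₂} (hF : IsRegMinimizer Φ w lam F) {l τ : Fin N → ℝ}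
    (hl : ∀ i, ENNReal.ofReal (l i) ≤ (F i).nuclearNorm) (hτ : ∀ i, 0 ≤ τ i)
    (hG : ∀ i, (G i).nuclearNorm ≤ ENNReal.ofReal (τ i)) :
    1 / 2 * ‖Φ F - w‖ ^ 2 + lam * ∑ i, l i ≤ 1 / 2 * ‖Φ G - w‖ ^ 2 + lam * ∑ i, τ i := by
  have hτ0 : 0 ≤ ∑ i, τ i := Finset.sum_nonneg fun i _ => hτ i
  refine (ENNReal.ofReal_le_ofReal_iff (by positivity)).1 ?_
  calc ENNReal.ofReal (1 / 2 * ‖Φ F - w‖ ^ 2 + lam * ∑ i, l i)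
      ≤ ENNReal.ofReal (1 / 2 * ‖Φ F - w‖ ^ 2) +
          ENNReal.ofReal lam * ENNReal.ofReal (∑ i, l i) := by
        rw [← ENNReal.ofReal_mul hlam]
        exact ENNReal.ofReal_add_le
    _ ≤ regObjective Φ w lam F := by
        unfold regObjective
        gcongr
        exact (Finset.le_sum_of_subadditive ENNReal.ofReal ENNReal.ofReal_zero.le
          (fun _ _ => ENNReal.ofReal_add_le) _ _).trans (Finset.sum_le_sum fun i _ => hl i)
    _ ≤ regObjective Φ w lam G := hF G
    _ ≤ ENNReal.ofReal (1 / 2 * ‖Φ G - w‖ ^ 2) +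
          ENNReal.ofReal lam * ENNReal.ofReal (∑ i, τ i) := by
        unfold regObjective
        gcongr
        rw [ENNReal.ofReal_sum_of_nonneg fun i _ => hτ i]
        exact Finset.sum_le_sum fun i _ => hG i
    _ = ENNReal.ofReal (1 / 2 * ‖Φ G - w‖ ^ 2 + lam * ∑ i, τ i) := by
        rw [← ENNReal.ofReal_mul hlam, ← ENNReal.ofReal_add (by positivity) (by positivity)]

/-- The quadratic inequality for the residual `r` and the Bregman distance `D` makes both of them
`O(δ)`. -/
theorem residual_and_bregman_le {c δ P r D : ℝ} (hc : 0 < c) (hδ : 0 < δ) (hP : 0 ≤ P)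
    (hD : 0 ≤ D)
    (h : 1 / 2 * r ^ 2 + c * δ * D ≤ 1 / 2 * δ ^ 2 + c * δ * (P * (r + δ))) :
    r ≤ (1 + 2 * c * P) * δ ∧ D ≤ (1 / (2 * c) + 2 * P * (1 + c * P)) * δ := by
  have hcD : 0 ≤ c * δ * D := by positivity
  have hcP : 0 ≤ c * P := by positivity
  -- Completing the square.
  have hr : r - c * P * δ ≤ (1 + c * P) * δ := by
    refine abs_le_of_sq_le_sq' ?_ (by positivity) |>.2
    nlinarith
  have hr' : r ≤ (1 + 2 * c * P) * δ := by linarith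
  refine ⟨hr', ?_⟩
  have h1 : c * δ * D ≤ 1 / 2 * δ ^ 2 + c * δ * (P * ((1 + 2 * c * P) * δ + δ)) := by
    have : c * δ * (P * (r + δ)) ≤ c * δ * (P * ((1 + 2 * c * P) * δ + δ)) := by gcongr
    nlinarith [sq_nonneg r]
  refine le_of_mul_le_mul_left (h1.trans_eq ?_) (by positivity : 0 < c * δ)
  field_simp
  ring

theorem norm_le_sum_norm_apply {ι : Type*} [Fintype ι] {V : ι → Type*}
    [∀ i, SeminormedAddCommGroup (V i)] (F : PiLp 2 V) : ‖F‖ ≤ ∑ i, ‖F i‖ := by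
  rw [PiLp.norm_eq_of_L2]
  exact Real.sqrt_le_iff.2 ⟨Finset.sum_nonneg fun _ _ => norm_nonneg _,
    Finset.sum_sq_le_sq_sum_of_nonneg fun _ _ => norm_nonneg _⟩

/-- If `Φ` is bounded below on the tangent space, then the error is controlled by its image under
`Φ` and by its normal component. -/
theorem sum_norm_sub_le {Φ : HSPow N H₁ H₂ →L[ℝ] H} {u : Fin N → H₁} (hu : ∀ i, ‖u i‖ = 1)
    {v : Fin N → H₂} (hv : ∀ i, ‖v i‖ = 1) {A : ℝ≥0}
    (hA : ∀ F ∈ tangentSpace u v, ‖F‖ ≤ A * ‖Φ F‖) (σ : Fin N → ℝ) {F : HSPow N H₁ H₂}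
    {a : Fin N → H₂} {b : Fin N → H₁} {Q : Fin N → HilbertSchmidt H₁ H₂}
    (hF : ∀ i, F i = tensor (u i) (a i) + tensor (b i) (v i) + Q i) :
    ∑ i, ‖(F - rankOneTuple σ u v) i‖ ≤
      N * (A * (‖Φ (F - rankOneTuple σ u v)‖ + ‖Φ‖ * ∑ i, ‖Q i‖)) + ∑ i, ‖Q i‖ := by
  set q : HSPow N H₁ H₂ := WithLp.toLp 2 Q
  set e := F - rankOneTuple σ u v
  have ht : e - q ∈ tangentSpace u v := by
    rw [← coe_tangentSubmodule hu hv]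
    intro i
    have h1 : (e - q) i = (tensor (u i) (a i) + tensor (b i) (v i)) -
        σ i • tensor (u i) (v i) := by
      change F i - σ i • tensor (u i) (v i) - Q i = _
      rw [hF]
      abel
    rw [h1]
    exact sub_mem ((mem_orthogonal_normalSpace_iff (hu i) (hv i)).2 ⟨_, _, rfl⟩)
      (Submodule.smul_mem _ _ (tensor_mem_orthogonal_normalSpace _ _))
  have hΦ : ‖Φ (e - q)‖ ≤ ‖Φ e‖ + ‖Φ‖ * ∑ i, ‖Q i‖ := by
    rw [map_sub]
    refine (norm_sub_le _ _).trans ?_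
    gcongr
    exact (Φ.le_opNorm q).trans (by gcongr; exact norm_le_sum_norm_apply q)
  calc ∑ i, ‖e i‖ ≤ ∑ i, (‖e - q‖ + ‖Q i‖) := by
        refine Finset.sum_le_sum fun i _ => ?_
        have h1 : e i = (e - q) i + Q i := (sub_add_cancel (e i) (Q i)).symm
        rw [h1]
        refine (norm_add_le _ _).trans ?_
        gcongr
        exact PiLp.norm_apply_le (e - q) i
    _ = N * ‖e - q‖ + ∑ i, ‖Q i‖ := by
        rw [Finset.sum_add_distrib, Finset.sum_const, Finset.card_univ, Fintype.card_fin,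
          nsmul_eq_mul]
    _ ≤ _ := by
        gcongr
        exact (hA _ ht).trans (by gcongr)

end Rate
end NuclearRecovery

end

open NuclearRecovery NuclearRecovery.HilbertSchmidt in
theorem mainTheorem3 {H₁ H₂ H : Type*}
    [NormedAddCommGroup H₁] [InnerProductSpace ℝ H₁] [CompleteSpace H₁]
    [TopologicalSpace.SeparableSpace H₁]
    [NormedAddCommGroup H₂] [InnerProductSpace ℝ H₂] [CompleteSpace H₂]
    [TopologicalSpace.SeparableSpace H₂]
    [NormedAddCommGroup H] [InnerProductSpace ℝ H] [CompleteSpace H]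
    [TopologicalSpace.SeparableSpace H]
    (N : ℕ) (hN : 1 ≤ N)
    (Φ : NuclearRecovery.HSPow N H₁ H₂ →L[ℝ] H)
    (σ : Fin N → ℝ) (hσ : ∀ i, 0 < σ i)
    (u : Fin N → H₁) (hu : ∀ i, ‖u i‖ = 1)
    (v : Fin N → H₂) (hv : ∀ i, ‖v i‖ = 1)
    (hinj : Set.InjOn Φ (NuclearRecovery.tangentSpace u v))
    (hclosed : IsClosed (Φ '' NuclearRecovery.tangentSpace u v))
    (hsource : NuclearRecovery.NonDegenerateSourceCondition Φ u v)
    (c : ℝ) (hc : 0 < c) :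
    ∃ C : ℝ, ∀ δ : ℝ, 0 < δ → ∀ zδ : H,
      ‖zδ - Φ (NuclearRecovery.rankOneTuple σ u v)‖ ≤ δ →
      ∀ Fδ : NuclearRecovery.HSPow N H₁ H₂,
        NuclearRecovery.IsRegMinimizer Φ zδ (c * δ) Fδ →
        ∑ i, ‖(Fδ - NuclearRecovery.rankOneTuple σ u v) i‖ ≤ C * δ := by
  obtain ⟨A, hA⟩ := exists_norm_le_of_mem_tangentSpace Φ hu hv hinj hclosed
  obtain ⟨_, ⟨p, rfl⟩, hK⟩ := hsource
  choose W hKW hWu hWv hW1 using hK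
  have hW : ∀ i, W i ∈ normalSpace (u i) (v i) := fun i => ⟨hWu i, hWv i⟩
  have hgap : ∀ i, 0 < 1 - ‖(W i).toCLM‖ := fun i => sub_pos.2 (hW1 i)
  set P : ℝ := ‖p‖
  -- The bounds on the data misfit, the Bregman distance and the normal components.
  set R : ℝ := 1 + 2 * c * P
  set D : ℝ := 1 / (2 * c) + 2 * P * (1 + c * P)
  set B : ℝ := ∑ i, (1 - ‖(W i).toCLM‖)⁻¹
  refine ⟨N * (A * ((R + 1) + ‖Φ‖ * (B * D))) + B * D, fun δ hδ zδ hzδ F hF => ?_⟩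
  choose a b Q hQ hFQ using fun i => exists_eq_tangent_add_normal (hu i) (hv i) (F i)
  set Fd := rankOneTuple σ u v
  set S : ℝ := ∑ i, (1 - ‖(W i).toCLM‖) * ‖Q i‖ with hS
  have hS0 : 0 ≤ S := Finset.sum_nonneg fun i _ => mul_nonneg (hgap i).le (norm_nonneg _)
  have hmin := hF.objective_le (G := Fd) (by positivity)
    (fun i => ofReal_inner_add_norm_normal_le_nuclearNorm (hu i) (hv i) (hW i) (hW1 i).le (hQ i)
      (hFQ i))
    (fun i => (hσ i).le) (fun i => nuclearNorm_smul_tensor_le (hσ i) (hu i) (hv i))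
  have hpF : inner ℝ p (Φ F) = ∑ i, inner ℝ (tensor (u i) (v i) + W i) (F i) := by
    rw [← ContinuousLinearMap.adjoint_inner_left, PiLp.inner_apply]
    simp_rw [hKW]
  have hpFd : inner ℝ p (Φ Fd) = ∑ i, σ i := by
    rw [← ContinuousLinearMap.adjoint_inner_left, PiLp.inner_apply]
    refine Finset.sum_congr rfl fun i _ => ?_
    change inner ℝ _ (σ i • tensor (u i) (v i)) = _
    rw [hKW, real_inner_smul_right, inner_add_left, inner_tensor_left, tensor_apply,
      real_inner_smul_right, real_inner_self_eq_norm_sq, real_inner_self_eq_norm_sq, hu, hv,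
      Submodule.inner_right_of_mem_orthogonal (hW i) (tensor_mem_orthogonal_normalSpace _ _)]
    ring
  rw [Finset.sum_add_distrib, ← hpF, ← hpFd, ← hS] at hmin
  set r : ℝ := ‖Φ F - zδ‖
  have hΦ : ‖Φ (F - Fd)‖ ≤ r + δ := by
    rw [map_sub]
    exact (norm_sub_le_norm_sub_add_norm_sub _ zδ _).trans (by gcongr)
  have hp : inner ℝ p (Φ Fd) - inner ℝ p (Φ F) ≤ P * (r + δ) := by
    rw [← inner_sub_right, ← map_sub]
    refine (real_inner_le_norm _ _).trans ?_
    rw [← neg_sub F Fd, map_neg, norm_neg]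
    gcongr
  have hres : ‖Φ Fd - zδ‖ ^ 2 ≤ δ ^ 2 := by
    rw [norm_sub_rev]
    gcongr
  obtain ⟨hrR, hSD⟩ := residual_and_bregman_le hc hδ (norm_nonneg p) hS0 (r := r) (by
    have := mul_le_mul_of_nonneg_left hp (by positivity : 0 ≤ c * δ)
    linarith)
  have hQS : ∑ i, ‖Q i‖ ≤ B * D * δ := by
    calc ∑ i, ‖Q i‖ ≤ ∑ i, (1 - ‖(W i).toCLM‖)⁻¹ * S := by
          refine Finset.sum_le_sum fun i _ => (le_inv_mul_iff₀ (hgap i)).2 ?_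
          exact Finset.single_le_sum (f := fun i => (1 - ‖(W i).toCLM‖) * ‖Q i‖)
            (fun j _ => mul_nonneg (hgap j).le (norm_nonneg _)) (Finset.mem_univ i)
      _ = B * S := (Finset.sum_mul _ _ _).symm
      _ ≤ B * (D * δ) := by
          gcongr
          exact Finset.sum_nonneg fun i _ => (inv_pos.2 (hgap i)).le
      _ = B * D * δ := (mul_assoc _ _ _).symm
  calc ∑ i, ‖(F - Fd) i‖
      ≤ N * (A * (‖Φ (F - Fd)‖ + ‖Φ‖ * ∑ i, ‖Q i‖)) + ∑ i, ‖Q i‖ :=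
        sum_norm_sub_le hu hv hA σ hFQ
    _ ≤ N * (A * ((R * δ + δ) + ‖Φ‖ * (B * D * δ))) + B * D * δ := by
        gcongr
        exact hΦ.trans (by gcongr)
    _ = _ := by ring
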